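/- **Setting.** A d-space is a topological space $X$ with a set of directed paths (d-paths) $p\colon I=[0,1]\to X$ that contains the constant paths and is closed under concatenation and under continuous non-decreasing reparametrization. A d-map is a continuous map sending d-paths to d-paths. $\vec P(X)_x^y$ is the space of d-paths from $x$ to $y$ (compact-open topology); $y$ is reachable from $x$ if $\vec P(X)_x^y\neq\emptyset$. The trace space $\vec T(X)_x^y$ is the quotient space of $\vec P(X)_x^y$ by the equivalence relation generated by $p\sim p\circ\varphi$, with $\varphi\colon I\to I$ continuous, non-decreasing and surjective. $\vec I$ denotes $I$ with the non-decreasing paths as d-paths; a path in a product of d-spaces is directed iff its components are. A d-map $f\colon X\to X$ is path space preserving if $\vec T(f)\colon\vec T(X)_x^y\to\vec T(X)_{f(x)}^{f(y)}$ is a homotopy equivalence for all $x,y$ with $y$ reachable from $x$. A map $f\colon X\to X$ is $+\mathcal F_\infty$ inessential (resp. $-\mathcal F_\infty$ inessential) if there is a d-map $H\colon X\times\vec I\to X$ with $H_0=\mathrm{id}_X$, $H_1=f$ (resp. $H_0=f$, $H_1=\mathrm{id}_X$) such that every $H_t$, $t\in I$, is path space preserving. A Euclidean cubical complex is a subset $X\subseteq\mathbb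 R^n$ that is the union of a (possibly infinite) set $K$, closed under taking faces, of elementary cubes $\prod_{i=1}^n J_i$, where each $J_i$ is $\{a_i\}$ or $[a_i,a_i+1]$ with $a_i\in\mathbb Z$; the d-paths are the paths for which $I$ has a finite partition such that on each subinterval the path stays in one cube of $K$ and has non-decreasing coordinates. The interior of an elementary cube is obtained by replacing its factors $[a_i,a_i+1]$ by $(a_i,a_i+1)$ and keeping its factors $\{a_i\}$. Two points of $X$ are cube-equivalent if they lie in the interior of the same cube of $K$. A d-map $h\colon X\to X$ is cube-preserving if $h_i(x)=x_i$ whenever $x_i\in\mathbb Z$, and $h$ maps the interior of every cube of $K$ into itself. It is of future (resp. past) type if $h(x)\ge x$ (resp. $h(x)\le x$) coordinatewise for all $x\in X$. **Proposition.** Let $X$ be a Euclidean cubical complex. 1. Every cube-preserving d-map $h\colon X\to X$ of future type is $+\mathcal F_\infty$ inessential. 2. Every cube-preserving d-map $h\colon X\to X$ of past type is $-\mathcal F_\infty$ inessential. 3. If $y$ is reachable from $x$ and $\sigma$ is a d-path in $X$ from $y$ to a point $y'$ that is cube-equivalent to $y$, then $\vec P(X)_x^y\to\vec P(X)_x^{y'}$,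 $\alpha\mapsto\alpha*\sigma$, is a homotopy equivalence. 4. If $y$ is reachable from $x$ and $\tau$ is a d-path in $X$ to $x$ from a point $x'$ that is cube-equivalent to $x$, then $\vec P(X)_x^y\to\vec P(X)_{x'}^{y}$, $\alpha\mapsto\tau*\alpha$, is a homotopy equivalence. -/

import Mathlib

open Set
open scoped unitInterval

/-! ### Directed spaces -/

/-- A structure of directed space (d-space) on a topological space `X`: a set of directed paths
`p : [0,1] → X` containing the constant paths and closed under concatenation and under
continuous non-decreasing reparametrization. -/
structure DStructure (X : Type*) [TopologicalSpace X] where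
  IsDPath : C(I, X) → Prop
  const : ∀ x : X, IsDPath (ContinuousMap.const I x)
  concat : ∀ {x y z : X} (p : Path x y) (q : Path y z),
    IsDPath p.toContinuousMap → IsDPath q.toContinuousMap → IsDPath (p.trans q).toContinuousMap
  reparam : ∀ (p : C(I, X)) (φ : C(I, I)), Monotone φ → IsDPath p → IsDPath (p.comp φ)

namespace DStructure

/-- The directed unit interval: the directed paths are the non-decreasing ones. -/
def interval : DStructure I where
  IsDPath p := Monotone p
  const _ := monotone_const
  concat := by
    intro x y z p q hp hq s t hst
    have hst' : (s : ℝ) ≤ t := hst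
    have hpy : ∀ u, p u ≤ y := fun u => by
      have h : p u ≤ p 1 := hp (unitInterval.le_one u)
      simpa using h
    have hqy : ∀ u, y ≤ q u := fun u => by
      have h : q 0 ≤ q u := hq (unitInterval.nonneg u)
      simpa using h
    show (p.trans q) s ≤ (p.trans q) t
    rw [Path.trans_apply, Path.trans_apply]
    split_ifs with h1 h2 h2
    · exact hp (show 2 * (s : ℝ) ≤ 2 * t by linarith)
    · exact (hpy _).trans (hqy _)
    · exact absurd (hst'.trans h2) h1
    · exact hq (show 2 * (s : ℝ) - 1 ≤ 2 * t - 1 by linarith)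
  reparam _ _ hφ hp := hp.comp hφ

/-- The product of two d-spaces: a path is directed if and only if both components are. -/
def prod {X Y : Type*} [TopologicalSpace X] [TopologicalSpace Y]
    (dX : DStructure X) (dY : DStructure Y) : DStructure (X × Y) where
  IsDPath p := dX.IsDPath (ContinuousMap.fst.comp p) ∧ dY.IsDPath (ContinuousMap.snd.comp p)
  const x := ⟨dX.const x.1, dY.const x.2⟩
  concat := by
    intro x y z p q hp hq
    have h1 := dX.concat (p.map continuous_fst) (q.map continuous_fst) hp.1 hq.1
    have h2 := dY.concat (p.map continuous_snd) (q.map continuous_snd) hp.2 hq.2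
    rw [← Path.map_trans] at h1 h2
    exact ⟨h1, h2⟩
  reparam p φ hφ hp := ⟨dX.reparam _ φ hφ hp.1, dY.reparam _ φ hφ hp.2⟩

variable {X Y : Type*} [TopologicalSpace X] [TopologicalSpace Y]

/-- A continuous map of d-spaces is a d-map if it sends directed paths to directed paths. -/
def IsDMap (dX : DStructure X) (dY : DStructure Y) (f : C(X, Y)) : Prop :=
  ∀ p : C(I, X), dX.IsDPath p → dY.IsDPath (f.comp p)

/-- The space of directed paths from `x` to `y`, with the compact-open topology
(inherited from the topology on `Path x y`). -/
abbrev DPath (d : DStructure X) (x y : X) : Type _ :=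
  {p : Path x y // d.IsDPath p.toContinuousMap}

/-- `y` is reachable from `x`. -/
def Reachable (d : DStructure X) (x y : X) : Prop := Nonempty (d.DPath x y)

/-- Concatenation of directed paths. -/
noncomputable def DPath.concat {d : DStructure X} {x y z : X} (p : d.DPath x y) (q : d.DPath y z) :
    d.DPath x z :=
  ⟨p.1.trans q.1, d.concat p.1 q.1 p.2 q.2⟩

/-- `q = p ∘ φ` for some continuous, non-decreasing and surjective `φ : [0,1] → [0,1]`. -/
def IsReparam {d : DStructure X} {x y : X} (p q : d.DPath x y) : Prop :=
  ∃ φ : C(I, I), Monotone φ ∧ Function.Surjective φ ∧ ∀ t, q.1 t = p.1 (φ t)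

/-- The trace space: directed paths from `x` to `y` modulo the equivalence relation generated by
reparametrization, with the quotient topology. -/
abbrev Trace (d : DStructure X) (x y : X) : Type _ :=
  Quot (IsReparam (d := d) (x := x) (y := y))

/-- The map on directed path spaces induced by a d-map. -/
def pathMap {dX : DStructure X} {dY : DStructure Y} {f : C(X, Y)} (hf : IsDMap dX dY f)
    (x y : X) (p : dX.DPath x y) : dY.DPath (f x) (f y) :=
  ⟨p.1.map f.continuous, hf _ p.2⟩

/-- The map on trace spaces induced by a d-map. -/
def traceMap {dX : DStructure X} {dY : DStructure Y} {f : C(X, Y)} (hf : IsDMap dX dY f)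
    (x y : X) : dX.Trace x y → dY.Trace (f x) (f y) :=
  Quot.map (pathMap hf x y) (by
    rintro p q ⟨φ, hm, hs, h⟩
    exact ⟨φ, hm, hs, fun t => congrArg f (h t)⟩)

end DStructure

/-- A function between topological spaces that is (continuous and) a homotopy equivalence. -/
def IsHomotopyEquivalence {A B : Type*} [TopologicalSpace A] [TopologicalSpace B]
    (f : A → B) : Prop :=
  ∃ e : ContinuousMap.HomotopyEquiv A B, (e : A → B) = f

namespace DStructure

variable {X : Type*} [TopologicalSpace X]

/-- `f` is a d-map inducing homotopy equivalences on the trace spaces between all reachable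
pairs of points. -/
def IsPathSpacePreserving (d : DStructure X) (f : C(X, X)) : Prop :=
  ∃ hf : IsDMap d d f, ∀ x y : X, d.Reachable x y → IsHomotopyEquivalence (traceMap hf x y)

/-- The level map `H_t` of a homotopy `H`. -/
def level (H : C(X × I, X)) (t : I) : C(X, X) :=
  H.comp ((ContinuousMap.id X).prodMk (ContinuousMap.const X t))

/-- A simple d-homotopy: a d-map from the product of `X` with the directed interval to `X`. -/
def IsSimpleDHomotopy (d : DStructure X) (H : C(X × I, X)) : Prop :=
  IsDMap (d.prod interval) d H

/-- `f` is future inessential with respect to homotopy equivalences: there is a path space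
preserving simple d-homotopy from the identity to `f`. -/
def IsFutureInessential (d : DStructure X) (f : C(X, X)) : Prop :=
  ∃ H : C(X × I, X), IsSimpleDHomotopy d H ∧ level H 0 = ContinuousMap.id X ∧ level H 1 = f ∧
    ∀ t : I, d.IsPathSpacePreserving (level H t)

/-- `f` is past inessential with respect to homotopy equivalences: there is a path space
preserving simple d-homotopy from `f` to the identity. -/
def IsPastInessential (d : DStructure X) (f : C(X, X)) : Prop :=
  ∃ H : C(X × I, X), IsSimpleDHomotopy d H ∧ level H 0 = f ∧ level H 1 = ContinuousMap.id X ∧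
    ∀ t : I, d.IsPathSpacePreserving (level H t)

end DStructure

/-! ### Partitions of subintervals of `[0,1]` -/

/-- `[a, b]` has a finite partition `a = t 0 ≤ t 1 ≤ ... ≤ t k = b` such that `R` holds for all
pairs of consecutive partition points. -/
def HasPartition (R : I → I → Prop) (a b : I) : Prop :=
  ∃ (k : ℕ) (t : ℕ → I), Monotone t ∧ t 0 = a ∧ t k = b ∧ ∀ i < k, R (t i) (t (i + 1))

theorem HasPartition.single {R : I → I → Prop} {a b : I} (hab : a ≤ b) (h : R a b) :
    HasPartition R a b := by
  refine ⟨1, fun i => if i = 0 then a else b, ?_, by simp, by simp, ?_⟩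
  · refine monotone_nat_of_le_succ fun i => ?_
    by_cases hi : i = 0 <;> simp [hi, hab]
  · intro i hi
    obtain rfl : i = 0 := by omega
    simpa using h

theorem HasPartition.trans {R : I → I → Prop} {a b c : I} (h₁ : HasPartition R a b)
    (h₂ : HasPartition R b c) : HasPartition R a c := by
  obtain ⟨k, t, ht, rfl, rfl, hk⟩ := h₁
  obtain ⟨l, s, hs, hs0, rfl, hl⟩ := h₂
  refine ⟨k + l, fun i => if i ≤ k then t i else s (i - k), ?_, by simp, ?_, ?_⟩
  · refine monotone_nat_of_le_succ fun i => ?_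
    rcases lt_trichotomy i k with h | rfl | h
    · simpa [h.le, Nat.succ_le_of_lt h] using ht (Nat.le_succ i)
    · simpa [← hs0] using hs (Nat.zero_le 1)
    · simpa [not_le.2 h, show ¬ i + 1 ≤ k by omega] using hs (by omega : i - k ≤ i + 1 - k)
  · rcases Nat.eq_zero_or_pos l with rfl | h
    · simpa using hs0.symm
    · simp [show ¬ k + l ≤ k by omega]
  · intro i hi
    rcases lt_trichotomy i k with h | rfl | h
    · simpa [h.le, Nat.succ_le_of_lt h] using hk i h
    · simpa [← hs0] using hl 0 (by omega)
    · have := hl (i - k) (by omega)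
      rw [show i - k + 1 = i + 1 - k by omega] at this
      simpa [not_le.2 h, show ¬ i + 1 ≤ k by omega] using this

theorem HasPartition.comp {R R' : I → I → Prop} {φ : I → I} (hc : Continuous φ) {A B : I}
    (H : ∀ a b a' b', A ≤ a' → a' ≤ b' → b' ≤ B → a ≤ φ a' → φ b' ≤ b → R a b → R' a' b')
    (hAB : A ≤ B) {a b : I} (hab : a < b) (haA : a ≤ φ A) (hBb : φ B ≤ b)
    (h : HasPartition R a b) : HasPartition R' A B := by
  obtain ⟨k, t, ht, rfl, rfl, hk⟩ := h
  obtain ⟨k, rfl⟩ : ∃ m, k = m + 1 :=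
    Nat.exists_eq_succ_of_ne_zero (by rintro rfl; exact lt_irrefl _ hab)
  have key : ∀ j ≤ k, ∀ A' B', A ≤ A' → A' ≤ B' → B' ≤ B → t 0 ≤ φ A' → φ B' ≤ t (j + 1) →
      HasPartition R' A' B' := by
    intro j
    induction j with
    | zero =>
      intro _ A' B' h1 h2 h3 h4 h5
      exact .single h2 (H _ _ _ _ h1 h2 h3 h4 h5 (hk 0 (by omega)))
    | succ j ih =>
      intro hj A' B' h1 h2 h3 h4 h5
      by_cases h6 : φ B' ≤ t (j + 1)
      · exact ih (by omega) A' B' h1 h2 h3 h4 h6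
      by_cases h7 : t (j + 1) ≤ φ A'
      · exact .single h2 (H _ _ _ _ h1 h2 h3 h7 h5 (hk (j + 1) (by omega)))
      obtain ⟨m, hm, hφm⟩ : t (j + 1) ∈ φ '' Icc A' B' :=
        intermediate_value_Icc h2 hc.continuousOn ⟨(not_le.1 h7).le, (not_le.1 h6).le⟩
      exact (ih (by omega) A' m h1 hm.1 (hm.2.trans h3) h4 hφm.le).trans
        (.single hm.2 (H _ _ _ _ (h1.trans hm.1) hm.2 h3 hφm.ge h5 (hk (j + 1) (by omega))))
  exact key k le_rfl A B le_rfl hAB le_rfl haA hBb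

/-! ### Euclidean cubical complexes -/

/-- An elementary cube of the lattice `ℤⁿ ⊆ ℝⁿ`: the product of the intervals
`[base i, base i + 1]` for `i ∈ dirs` and of the points `{base i}` for `i ∉ dirs`. -/
structure LatticeCube (n : ℕ) where
  base : Fin n → ℤ
  dirs : Finset (Fin n)

namespace LatticeCube

variable {n : ℕ}

/-- The closed cube as a subset of `ℝⁿ`. -/
def closedCell (c : LatticeCube n) : Set (Fin n → ℝ) :=
  {x | ∀ i, if i ∈ c.dirs then (c.base i : ℝ) ≤ x i ∧ x i ≤ c.base i + 1 else x i = c.base i}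

/-- The (relative) interior of the cube as a subset of `ℝⁿ`. -/
def openCell (c : LatticeCube n) : Set (Fin n → ℝ) :=
  {x | ∀ i, if i ∈ c.dirs then (c.base i : ℝ) < x i ∧ x i < c.base i + 1 else x i = c.base i}

/-- The lower face in direction `i` (meaningful for `i ∈ c.dirs`). -/
def lowerFace (c : LatticeCube n) (i : Fin n) : LatticeCube n where
  base := c.base
  dirs := c.dirs.erase i

/-- The upper face in direction `i` (meaningful for `i ∈ c.dirs`). -/
def upperFace (c : LatticeCube n) (i : Fin n) : LatticeCube n where
  base := Function.update c.base i (c.base i + 1)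
  dirs := c.dirs.erase i

end LatticeCube

/-- A Euclidean cubical complex: a subcomplex of the cubical complex `ℝⁿ` with vertex set `ℤⁿ`,
that is, a (possibly infinite) set of elementary cubes that is closed under faces. -/
structure EuclideanCubicalComplex (n : ℕ) where
  cells : Set (LatticeCube n)
  lowerFace_mem : ∀ c ∈ cells, ∀ i ∈ c.dirs, c.lowerFace i ∈ cells
  upperFace_mem : ∀ c ∈ cells, ∀ i ∈ c.dirs, c.upperFace i ∈ cells

namespace EuclideanCubicalComplex

variable {n : ℕ} (K : EuclideanCubicalComplex n)

/-- The underlying space, a subset of `ℝⁿ`. -/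
def space : Set (Fin n → ℝ) := ⋃ c ∈ K.cells, c.closedCell

/-- On `[a, b]` the path `p` stays in one cube of the complex and all of its coordinates are
non-decreasing. -/
def IsDirectedInCube (p : I → K.space) (a b : I) : Prop :=
  ∃ c ∈ K.cells, (∀ s ∈ Icc a b, (p s : Fin n → ℝ) ∈ c.closedCell) ∧
    MonotoneOn (fun s => (p s : Fin n → ℝ)) (Icc a b)

/-- The d-space structure of a Euclidean cubical complex: the directed paths are those that are
piecewise contained in cubes and non-decreasing there. -/
def dStructure : DStructure K.space where
  IsDPath p := HasPartition (K.IsDirectedInCube p) 0 1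
  const x := by
    obtain ⟨c, hc, hx⟩ := mem_iUnion₂.1 x.2
    exact .single zero_le_one ⟨c, hc, fun _ _ => hx, fun _ _ _ _ _ => le_rfl⟩
  concat := by
    intro x y z p q hp hq
    have hhalf : (0 : ℝ) ≤ 1 / 2 ∧ (1 / 2 : ℝ) ≤ 1 := by norm_num
    refine HasPartition.trans (b := ⟨1 / 2, hhalf⟩) ?_ ?_
    · refine hp.comp (φ := fun s => projIcc (0 : ℝ) 1 zero_le_one (2 * (s : ℝ)))
        (continuous_projIcc.comp (by fun_prop)) ?_ hhalf.1 zero_lt_one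
        (unitInterval.nonneg _) (unitInterval.le_one _)
      rintro a b a' b' - - hB ha hb ⟨c, hc, h1, h2⟩
      have hmono : ∀ s s' : I, s ≤ s' → projIcc (0 : ℝ) 1 zero_le_one (2 * (s : ℝ)) ≤
          projIcc 0 1 zero_le_one (2 * (s' : ℝ)) := fun s s' h =>
        monotone_projIcc _ (by have : (s : ℝ) ≤ s' := h; linarith)
      have hmem : ∀ s ∈ Icc a' b', projIcc (0 : ℝ) 1 zero_le_one (2 * (s : ℝ)) ∈ Icc a b :=
        fun s hs => ⟨ha.trans (hmono _ _ hs.1), (hmono _ _ hs.2).trans hb⟩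
      have heq : ∀ s ∈ Icc a' b', (p.trans q) s = p (projIcc (0 : ℝ) 1 zero_le_one (2 * (s : ℝ))) := by
        intro s hs
        have h : (s : ℝ) ≤ 1 / 2 := hs.2.trans hB
        rw [Path.trans_apply, dif_pos h, projIcc_of_mem]
      refine ⟨c, hc, fun s hs => ?_, fun s hs s' hs' hss => ?_⟩
      · show ((p.trans q) s : Fin n → ℝ) ∈ _
        rw [heq s hs]
        exact h1 _ (hmem s hs)
      · show ((p.trans q) s : Fin n → ℝ) ≤ (p.trans q) s'
        rw [heq s hs, heq s' hs']
        exact h2 (hmem s hs) (hmem s' hs') (hmono _ _ hss)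
    · refine hq.comp (φ := fun s => projIcc (0 : ℝ) 1 zero_le_one (2 * (s : ℝ) - 1))
        (continuous_projIcc.comp (by fun_prop)) ?_ hhalf.2 zero_lt_one
        (unitInterval.nonneg _) (unitInterval.le_one _)
      rintro a b a' b' hA - - ha hb ⟨c, hc, h1, h2⟩
      have hmono : ∀ s s' : I, s ≤ s' → projIcc (0 : ℝ) 1 zero_le_one (2 * (s : ℝ) - 1) ≤
          projIcc (0 : ℝ) 1 zero_le_one (2 * (s' : ℝ) - 1) := fun s s' h =>
        monotone_projIcc _ (by have : (s : ℝ) ≤ s' := h; linarith)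
      have hmem : ∀ s ∈ Icc a' b', projIcc (0 : ℝ) 1 zero_le_one (2 * (s : ℝ) - 1) ∈ Icc a b :=
        fun s hs => ⟨ha.trans (hmono _ _ hs.1), (hmono _ _ hs.2).trans hb⟩
      have heq : ∀ s ∈ Icc a' b',
          (p.trans q) s = q (projIcc (0 : ℝ) 1 zero_le_one (2 * (s : ℝ) - 1)) := by
        intro s hs
        have h : (1 / 2 : ℝ) ≤ s := hA.trans hs.1
        rw [Path.trans_apply]
        split_ifs with h'
        · have hs2 : (s : ℝ) = 1 / 2 := le_antisymm h' h
          have e1 : p ⟨2 * (s : ℝ), (unitInterval.mul_pos_mem_iff zero_lt_two).2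
              ⟨s.2.1, h'⟩⟩ = y := by
            convert p.target using 2
            exact Subtype.ext (by simp [hs2])
          have e2 : projIcc (0 : ℝ) 1 zero_le_one (2 * (s : ℝ) - 1) = 0 :=
            projIcc_of_le_left _ (by rw [hs2]; norm_num)
          rw [e1, e2, q.source]
        · rw [projIcc_of_mem]
      refine ⟨c, hc, fun s hs => ?_, fun s hs s' hs' hss => ?_⟩
      · show ((p.trans q) s : Fin n → ℝ) ∈ _
        rw [heq s hs]
        exact h1 _ (hmem s hs)
      · show ((p.trans q) s : Fin n → ℝ) ≤ (p.trans q) s'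
        rw [heq s hs, heq s' hs']
        exact h2 (hmem s hs) (hmem s' hs') (hmono _ _ hss)
  reparam := by
    intro p φ hφ hp
    refine hp.comp φ.continuous ?_ zero_le_one zero_lt_one
      (unitInterval.nonneg _) (unitInterval.le_one _)
    rintro a b a' b' - - - ha hb ⟨c, hc, h1, h2⟩
    have hmem : ∀ s ∈ Icc a' b', φ s ∈ Icc a b := fun s hs =>
      ⟨ha.trans (hφ hs.1), (hφ hs.2).trans hb⟩
    exact ⟨c, hc, fun s hs => h1 _ (hmem s hs),
      fun s hs s' hs' hss => h2 (hmem s hs) (hmem s' hs') (hφ hss)⟩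

/-- Two points are cube-equivalent if they lie in the interior of the same cube of the complex. -/
def CubeEquivalent (x x' : K.space) : Prop :=
  ∃ c ∈ K.cells, (x : Fin n → ℝ) ∈ c.openCell ∧ (x' : Fin n → ℝ) ∈ c.openCell

/-- A cube-preserving map: a d-map that fixes every integral coordinate and maps the interior of
every cube of the complex into itself. -/
def IsCubePreserving (h : C(K.space, K.space)) : Prop :=
  DStructure.IsDMap K.dStructure K.dStructure h ∧
  (∀ (x : K.space) (i : Fin n) (m : ℤ), (x : Fin n → ℝ) i = m → (h x : Fin n → ℝ) i = m) ∧
  (∀ c ∈ K.cells, ∀ x : K.space,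
    (x : Fin n → ℝ) ∈ c.openCell → (h x : Fin n → ℝ) ∈ c.openCell)

/-- `h(x) ≥ x` coordinatewise. -/
def IsFutureType (h : C(K.space, K.space)) : Prop :=
  ∀ (x : K.space) (i : Fin n), (x : Fin n → ℝ) i ≤ (h x : Fin n → ℝ) i

/-- `h(x) ≤ x` coordinatewise. -/
def IsPastType (h : C(K.space, K.space)) : Prop :=
  ∀ (x : K.space) (i : Fin n), (h x : Fin n → ℝ) i ≤ (x : Fin n → ℝ) i

end EuclideanCubicalComplex

/-! ### Homotopy equivalences -/

namespace IsHomotopyEquivalence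

variable {A B C : Type*} [TopologicalSpace A] [TopologicalSpace B] [TopologicalSpace C]

/-! The heart of the matter is that concatenation with a d-path `q` inside one open cube is a
homotopy equivalence of path spaces. If `q` runs from `y` to a cube-equivalent `y'`, an inverse
truncates a d-path `p` ending at `y'` to the coordinatewise minimum of `p` and `y`. A coordinate
changes only within an open interval between consecutive integers (or down to its lower end), so
truncation leaves no closed cube and produces a d-path (`closedCell_min`). Moving the truncation
point along `q`, the d-paths `min (p, q s)` followed by the rest of `q` after `s` join "truncate,
then concatenate" to a mere reparametrization of `p`. Concatenation at the beginning is dual, with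
maxima.

For a cube-preserving `h` of future type, the straight-line homotopy `H` from the identity to `h` is
a d-map, because closed cubes are convex and preserved by `h`. It makes `α * H(y, -)` homotopic to
`H(x, -) * h(α)` (`homotopic_track`). The tracks of `H` join cube-equivalent points, so both
concatenations are equivalences and two-out-of-three gives the same for `α ↦ h(α)`. Past type is
symmetric, with `H` running from `h` to the identity. Each level of `H` is again cube-preserving of
the same type, so the argument covers all levels.

The passage to trace spaces uses the coordinate sum as a canonical parameter: reparametrized paths
have the same natural parametrization, which therefore gives a homotopy inverse of the projection to
traces (`isHomotopyEquivalence_traceProj`). -/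

theorem of_inverse (f : C(A, B)) (g : C(B, A)) (h₁ : (g.comp f).Homotopic (.id A))
    (h₂ : (f.comp g).Homotopic (.id B)) : IsHomotopyEquivalence f :=
  ⟨⟨f, g, h₁, h₂⟩, rfl⟩

theorem exists_inverse {f : C(A, B)} (hf : IsHomotopyEquivalence f) :
    ∃ g : C(B, A), (g.comp f).Homotopic (.id A) ∧ (f.comp g).Homotopic (.id B) := by
  obtain ⟨e, he⟩ := hf
  have he' : e.toFun = f := DFunLike.coe_injective he
  exact ⟨e.invFun, he' ▸ e.left_inv, he' ▸ e.right_inv⟩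

theorem of_homotopic {f g : C(A, B)} (hf : IsHomotopyEquivalence f) (hfg : f.Homotopic g) :
    IsHomotopyEquivalence g := by
  obtain ⟨k, h₁, h₂⟩ := hf.exists_inverse
  exact of_inverse g k (((ContinuousMap.Homotopic.refl k).comp hfg.symm).trans h₁)
    ((hfg.symm.comp (.refl k)).trans h₂)

theorem comp {g : C(B, C)} {f : C(A, B)} (hg : IsHomotopyEquivalence g)
    (hf : IsHomotopyEquivalence f) : IsHomotopyEquivalence (g.comp f) := by
  obtain ⟨e, he⟩ := hf
  obtain ⟨e', he'⟩ := hg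
  refine ⟨e.trans e', ?_⟩
  ext a
  simp [congrFun he a, congrFun he' (f a)]

/-- If `g ∘ f` and `g` are homotopy equivalences, so is `f`. -/
theorem of_comp_left {g : C(B, C)} {f : C(A, B)} (hg : IsHomotopyEquivalence g)
    (hgf : IsHomotopyEquivalence (g.comp f)) : IsHomotopyEquivalence f := by
  obtain ⟨k, h₁, h₂⟩ := hg.exists_inverse
  have hk : IsHomotopyEquivalence k := of_inverse k g h₂ h₁
  exact (hk.comp hgf).of_homotopic (h₁.comp (.refl f))

/-- If `g ∘ f` and `f` are homotopy equivalences, so is `g`. -/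
theorem of_comp_right {g : C(B, C)} {f : C(A, B)} (hf : IsHomotopyEquivalence f)
    (hgf : IsHomotopyEquivalence (g.comp f)) : IsHomotopyEquivalence g := by
  obtain ⟨k, h₁, h₂⟩ := hf.exists_inverse
  have hk : IsHomotopyEquivalence k := of_inverse k f h₂ h₁
  exact (hgf.comp hk).of_homotopic ((ContinuousMap.Homotopic.refl g).comp h₂)

end IsHomotopyEquivalence

/-! ### Operations on the unit interval -/

namespace unitInterval

/-- Linear interpolation in the unit interval. -/
def lerp (s a b : I) : I :=
  ⟨(1 - s) * a + s * b, by
    have h := (convex_Icc (0 : ℝ) 1) a.2 b.2 (sub_nonneg.2 s.2.2) s.2.1 (by ring)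
    simpa using h⟩

@[simp] theorem coe_lerp (s a b : I) : (lerp s a b : ℝ) = (1 - s) * a + s * b := rfl

@[simp] theorem lerp_zero (a b : I) : lerp 0 a b = a := Subtype.ext (by simp)

@[simp] theorem lerp_one (a b : I) : lerp 1 a b = b := Subtype.ext (by simp)

@[simp] theorem lerp_self (s a : I) : lerp s a a = a := Subtype.ext (by simp; ring)

@[fun_prop]
theorem continuous_lerp {Y : Type*} [TopologicalSpace Y] {s a b : Y → I} (hs : Continuous s)
    (ha : Continuous a) (hb : Continuous b) : Continuous fun y => lerp (s y) (a y) (b y) := by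
  unfold lerp
  fun_prop

theorem lerp_mono (s : I) {a b a' b' : I} (ha : a ≤ a') (hb : b ≤ b') :
    lerp s a b ≤ lerp s a' b' :=
  Subtype.coe_le_coe.1 <| add_le_add (mul_le_mul_of_nonneg_left ha (sub_nonneg.2 s.2.2))
    (mul_le_mul_of_nonneg_left hb s.2.1)

/-- The reparametrization `t ↦ min (2 t) 1`. -/
noncomputable def firstHalf : C(I, I) :=
  ⟨fun t => projIcc 0 1 zero_le_one (2 * (t : ℝ)), continuous_projIcc.comp (by fun_prop)⟩

/-- The reparametrization `t ↦ max 0 (2 t - 1)`. -/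
noncomputable def secondHalf : C(I, I) :=
  ⟨fun t => projIcc 0 1 zero_le_one (2 * (t : ℝ) - 1), continuous_projIcc.comp (by fun_prop)⟩

theorem monotone_firstHalf : Monotone firstHalf := fun s t h =>
  monotone_projIcc zero_le_one (by have : (s : ℝ) ≤ t := h; linarith)

theorem monotone_secondHalf : Monotone secondHalf := fun s t h =>
  monotone_projIcc zero_le_one (by have : (s : ℝ) ≤ t := h; linarith)

@[simp] theorem firstHalf_zero : firstHalf 0 = 0 := by simp [firstHalf]

@[simp] theorem firstHalf_one : firstHalf 1 = 1 := projIcc_of_right_le zero_le_one (by norm_num)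

@[simp] theorem secondHalf_zero : secondHalf 0 = 0 := projIcc_of_le_left zero_le_one (by norm_num)

@[simp] theorem secondHalf_one : secondHalf 1 = 1 := projIcc_of_right_le zero_le_one (by norm_num)

theorem firstHalf_of_ge {t : I} (ht : (1 / 2 : ℝ) ≤ t) : firstHalf t = 1 :=
  projIcc_of_right_le zero_le_one (by linarith)

theorem secondHalf_of_le {t : I} (ht : (t : ℝ) ≤ 1 / 2) : secondHalf t = 0 :=
  projIcc_of_le_left zero_le_one (by linarith)

end unitInterval

open unitInterval

/-- With the clamped maps `firstHalf` and `secondHalf`, concatenation is described by total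
self-maps of `I`, which can be interpolated by `lerp`. Both descriptions hold at `1 / 2`. -/
theorem Path.trans_of_le {X : Type*} [TopologicalSpace X] {x y z : X} (p : Path x y)
    (q : Path y z) {t : I} (ht : (t : ℝ) ≤ 1 / 2) : (p.trans q) t = p (firstHalf t) := by
  rw [Path.trans_apply, dif_pos ht]
  congr 1
  exact (projIcc_of_mem zero_le_one _).symm

theorem Path.trans_of_ge {X : Type*} [TopologicalSpace X] {x y z : X} (p : Path x y)
    (q : Path y z) {t : I} (ht : (1 / 2 : ℝ) ≤ t) : (p.trans q) t = q (secondHalf t) := by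
  rcases ht.eq_or_lt with h | h
  · rw [Path.trans_of_le p q h.ge, firstHalf_of_ge ht, secondHalf_of_le h.ge]
    simp
  · rw [Path.trans_apply, dif_neg (not_le.2 h)]
    congr 1
    exact (projIcc_of_mem zero_le_one _).symm

/-! ### Spaces of directed paths -/

namespace DStructure

variable {X : Type*} [TopologicalSpace X] {d : DStructure X}

namespace DPath

@[fun_prop]
theorem continuous_apply {Y : Type*} [TopologicalSpace Y] {x y : X} {g : Y → d.DPath x y}
    {t : Y → I} (hg : Continuous g) (ht : Continuous t) :
    Continuous fun a => (g a).1 (t a) :=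
  (continuous_subtype_val.comp hg).eval ht

theorem continuous_of_uncurry {Y : Type*} [TopologicalSpace Y] {x y : X} {g : Y → d.DPath x y}
    (hg : Continuous fun q : Y × I => (g q.1).1 q.2) : Continuous g :=
  continuous_induced_rng.2 (Path.continuous_uncurry_iff.1 hg)

theorem homotopic_of_uncurry {A : Type*} [TopologicalSpace A] {x y : X} {f g : C(A, d.DPath x y)}
    (F : I → A → d.DPath x y) (hF : Continuous fun q : (I × A) × I => (F q.1.1 q.1.2).1 q.2)
    (h₀ : ∀ a t, (F 0 a).1 t = (f a).1 t) (h₁ : ∀ a t, (F 1 a).1 t = (g a).1 t) :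
    f.Homotopic g :=
  ⟨{ toFun := fun q => F q.1 q.2
     continuous_toFun := continuous_of_uncurry (g := fun q : I × A => F q.1 q.2) hF
     map_zero_left := fun a => Subtype.ext (Path.ext (funext (h₀ a)))
     map_one_left := fun a => Subtype.ext (Path.ext (funext (h₁ a))) }⟩

/-- Concatenation with a fixed directed path at the end. -/
noncomputable def concatRight {y z : X} (x : X) (q : d.DPath y z) :
    C(d.DPath x y, d.DPath x z) :=
  ⟨fun p => p.concat q, continuous_induced_rng.2
    (continuous_subtype_val.path_trans continuous_const)⟩

/-- Concatenation with a fixed directed path at the beginning. -/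
noncomputable def concatLeft {x y : X} (q : d.DPath x y) (z : X) :
    C(d.DPath y z, d.DPath x z) :=
  ⟨fun p => q.concat p, continuous_induced_rng.2
    (continuous_const.path_trans continuous_subtype_val)⟩

/-- Precomposition with a non-decreasing self-map of the interval fixing the end points. -/
def reparam {x y : X} (φ : C(I, I)) (hφ : Monotone φ) (h₀ : φ 0 = 0) (h₁ : φ 1 = 1)
    (p : d.DPath x y) : d.DPath x y :=
  ⟨p.1.reparam φ φ.continuous h₀ h₁, d.reparam p.1.toContinuousMap φ hφ p.2⟩

/-- A continuous self-map of the space of directed paths which acts by reparametrization with a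
fixed function is homotopic to the identity. -/
theorem homotopic_id_of_reparam {x y : X} (f : C(d.DPath x y, d.DPath x y)) (φ : C(I, I))
    (hφ : Monotone φ) (h₀ : φ 0 = 0) (h₁ : φ 1 = 1) (hf : ∀ p t, (f p).1 t = p.1 (φ t)) :
    f.Homotopic (.id _) := by
  refine homotopic_of_uncurry
    (fun s p => p.reparam ⟨fun t => lerp s (φ t) t, by fun_prop⟩
      (fun t t' h => lerp_mono s (hφ h) h) (by simp [h₀]) (by simp [h₁])) ?_ ?_ ?_
  · show Continuous fun q : (I × d.DPath x y) × I => q.1.2.1 (lerp q.1.1 (φ q.2) q.2)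
    fun_prop
  · intro p t
    show p.1 (lerp 0 (φ t) t) = _
    rw [hf, lerp_zero]
  · intro p t
    show p.1 (lerp 1 (φ t) t) = _
    rw [lerp_one]
    rfl

end DPath

/-- The map on spaces of directed paths induced by a d-map, as a continuous map. -/
def pathCMap {f : C(X, X)} (hf : IsDMap d d f) (x y : X) :
    C(d.DPath x y, d.DPath (f x) (f y)) :=
  ⟨pathMap hf x y, DPath.continuous_of_uncurry (by
    show Continuous fun q : d.DPath x y × I => f (q.1.1 q.2)
    fun_prop)⟩

/-- The map on trace spaces induced by a d-map, as a continuous map. -/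
def traceCMap {f : C(X, X)} (hf : IsDMap d d f) (x y : X) :
    C(d.Trace x y, d.Trace (f x) (f y)) :=
  ⟨traceMap hf x y, continuous_quot_lift _ (continuous_quot_mk.comp (pathCMap hf x y).continuous)⟩

/-- The projection from the space of directed paths to the trace space. -/
def traceProj (d : DStructure X) (x y : X) : C(d.DPath x y, d.Trace x y) :=
  ⟨Quot.mk _, continuous_quot_mk⟩

/-- The track of a point under a simple d-homotopy. -/
def track {H : C(X × I, X)} (hH : d.IsSimpleDHomotopy H) {f g : C(X, X)}
    (h₀ : ∀ x, H (x, 0) = f x) (h₁ : ∀ x, H (x, 1) = g x) (x : X) : d.DPath (f x) (g x) :=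
  ⟨⟨H.comp ((ContinuousMap.const I x).prodMk (.id I)), h₀ x, h₁ x⟩,
    hH _ ⟨d.const x, monotone_id⟩⟩

/-- A simple d-homotopy from `f` to `g` gives a homotopy between `α ↦ f(α) * H(y, -)` and
`α ↦ H(x, -) * g(α)`. -/
theorem homotopic_track {H : C(X × I, X)} (hH : d.IsSimpleDHomotopy H) {f g : C(X, X)}
    (hf : IsDMap d d f) (hg : IsDMap d d g)
    (h₀ : ∀ x, H (x, 0) = f x) (h₁ : ∀ x, H (x, 1) = g x) (x y : X) :
    ((DPath.concatRight (f x) (track hH h₀ h₁ y)).comp (pathCMap hf x y)).Homotopic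
      ((DPath.concatLeft (track hH h₀ h₁ x) (g y)).comp (pathCMap hg x y)) := by
  -- The map `(a, b) ↦ H (p a, b)` on the square is restricted to monotone curves from corner to
  -- corner: the staircase through `(1, 0)` at `s = 0`, the staircase through `(0, 1)` at `s = 1`,
  -- and their convex combinations in between.
  refine DPath.homotopic_of_uncurry
    (fun s p => ⟨⟨H.comp ((p.1.toContinuousMap.comp
        ⟨fun t => lerp s (firstHalf t) (secondHalf t), by fun_prop⟩).prodMk
        ⟨fun t => lerp s (secondHalf t) (firstHalf t), by fun_prop⟩), ?_, ?_⟩,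
      hH _ ⟨d.reparam _ _ (fun t t' h => lerp_mono s (monotone_firstHalf h)
        (monotone_secondHalf h)) p.2, fun t t' h => lerp_mono s (monotone_secondHalf h)
        (monotone_firstHalf h)⟩⟩) ?_ ?_ ?_
  · simp [h₀]
  · simp [h₁]
  · show Continuous fun q : (I × d.DPath x y) × I =>
      H (q.1.2.1 (lerp q.1.1 (firstHalf q.2) (secondHalf q.2)),
        lerp q.1.1 (secondHalf q.2) (firstHalf q.2))
    fun_prop
  · intro p t
    show H (p.1 (lerp 0 (firstHalf t) (secondHalf t)), lerp 0 (secondHalf t) (firstHalf t)) =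
      ((p.1.map f.continuous).trans (track hH h₀ h₁ y).1) t
    rw [lerp_zero, lerp_zero]
    rcases le_total (t : ℝ) (1 / 2) with ht | ht
    · rw [Path.trans_of_le _ _ ht, secondHalf_of_le ht, h₀]
      rfl
    · rw [Path.trans_of_ge _ _ ht, firstHalf_of_ge ht, p.1.target]
      rfl
  · intro p t
    show H (p.1 (lerp 1 (firstHalf t) (secondHalf t)), lerp 1 (secondHalf t) (firstHalf t)) =
      ((track hH h₀ h₁ x).1.trans (p.1.map g.continuous)) t
    rw [lerp_one, lerp_one]
    rcases le_total (t : ℝ) (1 / 2) with ht | ht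
    · rw [Path.trans_of_le _ _ ht, secondHalf_of_le ht, p.1.source]
      rfl
    · rw [Path.trans_of_ge _ _ ht, firstHalf_of_ge ht, h₁]
      rfl

end DStructure

open DStructure

/-! ### Cells and directed paths of a Euclidean cubical complex -/

namespace LatticeCube

variable {n : ℕ}

theorem openCell_subset_closedCell (c : LatticeCube n) : c.openCell ⊆ c.closedCell := by
  intro z hz i
  have h := hz i
  split_ifs at h ⊢ with hi
  · exact ⟨h.1.le, h.2.le⟩
  · exact h

theorem isClosed_closedCell (c : LatticeCube n) : IsClosed c.closedCell := by
  simp only [closedCell, ofPred_forall]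
  refine isClosed_iInter fun i => ?_
  split_ifs
  · exact (isClosed_le continuous_const (continuous_apply i)).inter
      (isClosed_le (continuous_apply i) continuous_const)
  · exact isClosed_eq (continuous_apply i) continuous_const

/-- A linear combination of two points of a closed cell lies in the cell. -/
theorem closedCell_lerp (c : LatticeCube n) {z w u : Fin n → ℝ} (hz : z ∈ c.closedCell)
    (hw : w ∈ c.closedCell) (s : I) (hu : ∀ i, u i = (1 - s) * z i + s * w i) :
    u ∈ c.closedCell := by
  intro i
  have hs₀ : (0 : ℝ) ≤ s := s.2.1
  have hs₁ : (0 : ℝ) ≤ 1 - s := sub_nonneg.2 s.2.2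
  have h₁ := hz i
  have h₂ := hw i
  rw [hu]
  split_ifs at h₁ h₂ ⊢ with hi
  · exact ⟨by nlinarith, by nlinarith⟩
  · rw [h₁, h₂]
    ring

/-- A linear combination of two points of an open cell lies in the cell. -/
theorem openCell_lerp (c : LatticeCube n) {z w u : Fin n → ℝ} (hz : z ∈ c.openCell)
    (hw : w ∈ c.openCell) (s : I) (hu : ∀ i, u i = (1 - s) * z i + s * w i) :
    u ∈ c.openCell := by
  intro i
  have h₁ := hz i
  have h₂ := hw i
  rw [hu]
  split_ifs at h₁ h₂ ⊢ with hi
  · exact (convex_Ioo (c.base i : ℝ) (c.base i + 1)) h₁ h₂ (sub_nonneg.2 s.2.2) s.2.1 (by ring)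
  · rw [h₁, h₂]
    ring

/-- The centre of a cell. -/
noncomputable def center (c : LatticeCube n) : Fin n → ℝ :=
  fun i => if i ∈ c.dirs then c.base i + 1 / 2 else c.base i

/-- The open segment from a point of a closed cell to the centre lies in the open cell. -/
theorem openCell_lerp_center (c : LatticeCube n) {z u : Fin n → ℝ} (hz : z ∈ c.closedCell)
    {s : I} (hs : 0 < s) (hu : ∀ i, u i = (1 - s) * z i + s * c.center i) :
    u ∈ c.openCell := by
  intro i
  have hs₀ : (0 : ℝ) < s := hs
  have hs₁ : (0 : ℝ) ≤ 1 - s := sub_nonneg.2 s.2.2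
  have h₁ := hz i
  rw [hu]
  unfold center
  split_ifs at h₁ ⊢ with hi
  · exact ⟨by nlinarith, by nlinarith⟩
  · rw [h₁]
    ring

/-- Changing coordinates of a point of a closed cell without leaving the open unit interval with
integral end points containing them does not leave the cell. -/
theorem closedCell_of_unit_interval (c : LatticeCube n) {z w : Fin n → ℝ}
    (hz : z ∈ c.closedCell)
    (h : ∀ i, w i = z i ∨ ∃ b : ℤ, (b < z i ∧ z i < b + 1) ∧ (b ≤ w i ∧ w i ≤ b + 1)) :
    w ∈ c.closedCell := by
  intro i
  have h₁ := hz i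
  rcases h i with h | ⟨b, ⟨hb₁, hb₂⟩, hw⟩
  · rw [h]
    exact h₁
  -- An open interval `(b, b + 1)` contains no integer and meets `[base i, base i + 1]` only if `b =
  -- base i`.
  · split_ifs at h₁ ⊢ with hi
    · have h₂ : c.base i < b + 1 := by exact_mod_cast h₁.1.trans_lt hb₂
      have h₃ : b < c.base i + 1 := by exact_mod_cast hb₁.trans_le h₁.2
      obtain rfl : c.base i = b := by omega
      exact hw
    · rw [h₁] at hb₁ hb₂
      have h₂ : c.base i < b + 1 := by exact_mod_cast hb₂
      have h₃ : b < c.base i := by exact_mod_cast hb₁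
      omega

end LatticeCube

namespace EuclideanCubicalComplex

variable {n : ℕ} (K : EuclideanCubicalComplex n)

theorem mem_space {z : Fin n → ℝ} : z ∈ K.space ↔ ∃ c ∈ K.cells, z ∈ c.closedCell := by
  simp [space]

/-- Every point lies in the interior of some cube of the complex. -/
theorem exists_mem_openCell (x : K.space) : ∃ c ∈ K.cells, (x : Fin n → ℝ) ∈ c.openCell := by
  obtain ⟨c, hc, hx⟩ := K.mem_space.1 x.2
  -- Induction on the dimension: a point of a closed cube outside its interior lies in a face of one
  -- dimension less.
  induction hk : c.dirs.card generalizing c with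
  | zero =>
    refine ⟨c, hc, fun i => ?_⟩
    have h := hx i
    have hi : i ∉ c.dirs := by simp [Finset.card_eq_zero.1 hk]
    simpa [hi] using h
  | succ k ih =>
    by_cases hin : (x : Fin n → ℝ) ∈ c.openCell
    · exact ⟨c, hc, hin⟩
    obtain ⟨i, hi⟩ := not_forall.1 hin
    have hxi := hx i
    by_cases hd : i ∈ c.dirs
    swap
    · simp only [hd, if_false] at hi hxi
      exact absurd hxi hi
    simp only [hd, if_true, not_and_or, not_lt] at hi hxi
    have hcard : (c.dirs.erase i).card = k := by rw [Finset.card_erase_of_mem hd, hk]; rfl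
    rcases hi with hi | hi
    · refine ih _ (K.lowerFace_mem c hc i hd) (fun j => ?_) hcard
      have hj := hx j
      by_cases hij : j = i
      · subst hij
        simpa [LatticeCube.lowerFace] using le_antisymm hi hxi.1
      · simpa [LatticeCube.lowerFace, hij] using hj
    · refine ih _ (K.upperFace_mem c hc i hd) (fun j => ?_) hcard
      have hj := hx j
      by_cases hij : j = i
      · subst hij
        simpa [LatticeCube.upperFace] using le_antisymm hxi.2 hi
      · simpa [LatticeCube.upperFace, hij] using hj

/-- A self-map preserving the open cells preserves the closed cells. -/
theorem mapsTo_closedCell {h : C(K.space, K.space)} {c : LatticeCube n} (hc : c ∈ K.cells)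
    (hh : ∀ x : K.space, (x : Fin n → ℝ) ∈ c.openCell → (h x : Fin n → ℝ) ∈ c.openCell)
    (x : K.space) (hx : (x : Fin n → ℝ) ∈ c.closedCell) : (h x : Fin n → ℝ) ∈ c.closedCell := by
  have hcen : c.center ∈ c.closedCell :=
    c.openCell_subset_closedCell (c.openCell_lerp_center hx (s := 1) zero_lt_one (by simp))
  -- The segment from `x` to the centre is in the open cell for `s > 0`, where the hypothesis
  -- applies; the closed cell then retains the limit `s → 0`.
  let g : I → K.space := fun s => ⟨fun i => (1 - s) * (x : Fin n → ℝ) i + s * c.center i,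
    K.mem_space.2 ⟨c, hc, c.closedCell_lerp hx hcen s fun _ => rfl⟩⟩
  have hg : Continuous g := by
    refine Continuous.subtype_mk ?_ _
    fun_prop
  have h₀ : g 0 = x := Subtype.ext (by ext i; simp [g])
  have hcl : IsClosed {s : I | (h (g s) : Fin n → ℝ) ∈ c.closedCell} :=
    c.isClosed_closedCell.preimage (by fun_prop)
  have hsub : Ioi (0 : I) ⊆ {s : I | (h (g s) : Fin n → ℝ) ∈ c.closedCell} := fun s hs =>
    c.openCell_subset_closedCell (hh _ (c.openCell_lerp_center hx hs fun _ => rfl))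
  have hmem : (0 : I) ∈ closure (Ioi (0 : I)) := by
    rw [closure_Ioi' ⟨1, zero_lt_one⟩]
    exact self_mem_Ici
  have h := hcl.closure_subset_iff.2 hsub hmem
  rwa [mem_ofPred_eq, h₀] at h

variable {K}

/-- Directed paths have non-decreasing coordinates. -/
theorem monotone_of_isDPath {p : C(I, K.space)} (hp : K.dStructure.IsDPath p) :
    Monotone fun s => (p s : Fin n → ℝ) := by
  obtain ⟨k, t, ht, h₀, h₁, hk⟩ := hp
  have key : ∀ j ≤ k, MonotoneOn (fun s => (p s : Fin n → ℝ)) (Icc (t 0) (t j)) := by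
    intro j
    induction j with
    | zero => simp
    | succ j ih =>
      intro hj
      obtain ⟨c, -, -, hm⟩ := hk j (by omega)
      rw [← Icc_union_Icc_eq_Icc (ht (Nat.zero_le j)) (ht (Nat.le_succ j))]
      exact (ih (by omega)).union_right hm (isGreatest_Icc (ht (Nat.zero_le j)))
        (isLeast_Icc (ht (Nat.le_succ j)))
  have h := key k le_rfl
  rw [h₀, h₁] at h
  exact fun s s' hs => h ⟨nonneg s, le_one s⟩ ⟨nonneg s', le_one s'⟩ hs

/-- A monotone path that stays in the cubes visited by a directed path is directed. -/
theorem isDPath_of_mapsTo {p q : C(I, K.space)} (hp : K.dStructure.IsDPath p)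
    (hq : Monotone fun s => (q s : Fin n → ℝ))
    (h : ∀ s, ∀ c ∈ K.cells, (p s : Fin n → ℝ) ∈ c.closedCell →
      (q s : Fin n → ℝ) ∈ c.closedCell) : K.dStructure.IsDPath q := by
  obtain ⟨k, t, ht, h₀, h₁, hk⟩ := hp
  refine ⟨k, t, ht, h₀, h₁, fun i hi => ?_⟩
  obtain ⟨c, hc, hmem, -⟩ := hk i hi
  exact ⟨c, hc, fun s hs => h s c hc (hmem s hs), hq.monotoneOn _⟩

theorem dPath_mono {x y : K.space} (p : K.dStructure.DPath x y) {s t : I} (h : s ≤ t) (i : Fin n) :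
    (p.1 s : Fin n → ℝ) i ≤ (p.1 t : Fin n → ℝ) i :=
  monotone_of_isDPath p.2 h i

theorem source_le {x y : K.space} (p : K.dStructure.DPath x y) (t : I) (i : Fin n) :
    (x : Fin n → ℝ) i ≤ (p.1 t : Fin n → ℝ) i := by
  simpa using dPath_mono p (nonneg' (t := t)) i

theorem le_target {x y : K.space} (p : K.dStructure.DPath x y) (t : I) (i : Fin n) :
    (p.1 t : Fin n → ℝ) i ≤ (y : Fin n → ℝ) i := by
  simpa using dPath_mono p (le_one' (t := t)) i

/-! ### Concatenation with a directed path in an open cell -/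

/-- Where the minimum differs from `z`, one has `y i ≤ w i < z i ≤ y' i`. In a direction of `c` this
puts `z i` and `w i` in the same open unit interval, so no cube containing `z` is left; in the other
directions `y i = y' i` excludes it. -/
theorem closedCell_min {y y' z w : Fin n → ℝ} {c : LatticeCube n} (hy : y ∈ c.openCell)
    (hy' : y' ∈ c.openCell) (hyw : ∀ i, y i ≤ w i) (hwy' : ∀ i, w i ≤ y' i)
    (hz : ∀ i, z i ≤ y' i) {e : LatticeCube n} (he : z ∈ e.closedCell) :
    (fun i => min (z i) (w i)) ∈ e.closedCell := by
  refine e.closedCell_of_unit_interval he fun i => ?_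
  rcases le_or_gt (z i) (w i) with h | h
  · exact .inl (min_eq_left h)
  have h₁ := hy i
  have h₂ := hy' i
  have := hyw i
  have := hwy' i
  have := hz i
  split_ifs at h₁ h₂ with hi
  · refine .inr ⟨c.base i, ⟨by linarith, by linarith⟩, ?_⟩
    simp only [min_eq_right h.le]
    exact ⟨by linarith, by linarith⟩
  · exact .inl (by simp only [min_eq_right h.le]; linarith)

theorem closedCell_max {y y' z w : Fin n → ℝ} {c : LatticeCube n} (hy : y ∈ c.openCell)
    (hy' : y' ∈ c.openCell) (hyw : ∀ i, y i ≤ w i) (hwy' : ∀ i, w i ≤ y' i)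
    (hz : ∀ i, y i ≤ z i) {e : LatticeCube n} (he : z ∈ e.closedCell) :
    (fun i => max (z i) (w i)) ∈ e.closedCell := by
  refine e.closedCell_of_unit_interval he fun i => ?_
  rcases le_or_gt (w i) (z i) with h | h
  · exact .inl (max_eq_left h)
  have h₁ := hy i
  have h₂ := hy' i
  have := hyw i
  have := hwy' i
  have := hz i
  split_ifs at h₁ h₂ with hi
  · refine .inr ⟨c.base i, ⟨by linarith, by linarith⟩, ?_⟩
    simp only [max_eq_right h.le]
    exact ⟨by linarith, by linarith⟩
  · exact .inl (by simp only [max_eq_right h.le]; linarith)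

theorem continuous_coord {Y : Type*} [TopologicalSpace Y] {x y : K.space}
    {g : Y → K.dStructure.DPath x y} {t : Y → I} (hg : Continuous g) (ht : Continuous t)
    (i : Fin n) : Continuous fun a => ((g a).1 (t a) : Fin n → ℝ) i :=
  (continuous_apply i).comp (continuous_subtype_val.comp (DPath.continuous_apply hg ht))

theorem continuous_of_coord {Y : Type*} [TopologicalSpace Y] {g : Y → K.space}
    (h : ∀ i, Continuous fun a => (g a : Fin n → ℝ) i) : Continuous g :=
  continuous_induced_rng.2 (continuous_pi h)

/-- The directed path given by a monotone path in `ℝⁿ` that stays in the cubes visited by a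
directed path. -/
def mkDPath {x y z w : K.space} (p : K.dStructure.DPath x y) (q : I → Fin n → ℝ)
    (hq : ∀ i, Continuous fun t => q t i) (hm : Monotone q)
    (h : ∀ s, ∀ c ∈ K.cells, (p.1 s : Fin n → ℝ) ∈ c.closedCell → q s ∈ c.closedCell)
    (h₀ : ∀ i, q 0 i = (z : Fin n → ℝ) i) (h₁ : ∀ i, q 1 i = (w : Fin n → ℝ) i) :
    K.dStructure.DPath z w :=
  have hmem : ∀ t, q t ∈ K.space := fun t => by
    obtain ⟨c, hc, ht⟩ := K.mem_space.1 (p.1 t).2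
    exact K.mem_space.2 ⟨c, hc, h t c hc ht⟩
  ⟨⟨⟨fun t => ⟨q t, hmem t⟩, continuous_of_coord hq⟩, Subtype.ext (funext h₀),
    Subtype.ext (funext h₁)⟩, isDPath_of_mapsTo p.2 hm h⟩

/-- The minimum of a directed path with a point `w` of the open cell of its end point. -/
def minPath {x y y' : K.space} (hc : K.CubeEquivalent y y') {w : K.space}
    (hxw : ∀ i, (x : Fin n → ℝ) i ≤ (w : Fin n → ℝ) i)
    (hyw : ∀ i, (y : Fin n → ℝ) i ≤ (w : Fin n → ℝ) i)
    (hwy' : ∀ i, (w : Fin n → ℝ) i ≤ (y' : Fin n → ℝ) i) (p : K.dStructure.DPath x y') :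
    K.dStructure.DPath x w :=
  mkDPath p (fun t i => min ((p.1 t : Fin n → ℝ) i) ((w : Fin n → ℝ) i))
    (fun i => (continuous_coord continuous_const continuous_id i).min continuous_const)
    (fun _ _ h i => min_le_min_right _ (dPath_mono p h i))
    (fun t _ _ he => by
      obtain ⟨c, -, hy, hy'⟩ := hc
      exact closedCell_min hy hy' hyw hwy' (le_target p t) he)
    (fun i => by simp [hxw]) (fun i => by simp [hwy'])

/-- The maximum of a directed path with a point `w` of the open cell of its starting point. -/
def maxPath {x' x y : K.space} (hc : K.CubeEquivalent x' x) {w : K.space}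
    (hx'w : ∀ i, (x' : Fin n → ℝ) i ≤ (w : Fin n → ℝ) i)
    (hwx : ∀ i, (w : Fin n → ℝ) i ≤ (x : Fin n → ℝ) i)
    (hwy : ∀ i, (w : Fin n → ℝ) i ≤ (y : Fin n → ℝ) i) (p : K.dStructure.DPath x' y) :
    K.dStructure.DPath w y :=
  mkDPath p (fun t i => max ((p.1 t : Fin n → ℝ) i) ((w : Fin n → ℝ) i))
    (fun i => (continuous_coord continuous_const continuous_id i).max continuous_const)
    (fun _ _ h i => max_le_max_right _ (dPath_mono p h i))
    (fun t _ _ he => by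
      obtain ⟨c, -, hx', hx⟩ := hc
      exact closedCell_max hx' hx hx'w hwx (source_le p t) he)
    (fun i => by simp [hx'w]) (fun i => by simp [hwy])

/-- The part of a directed path after time `s`. -/
def tailPath {X : Type*} [TopologicalSpace X] {d : DStructure X} {y z : X} (q : d.DPath y z)
    (s : I) : d.DPath (q.1 s) z :=
  ⟨⟨q.1.toContinuousMap.comp ⟨fun t => max s t, by fun_prop⟩,
    congrArg q.1 (max_eq_left nonneg'), (congrArg q.1 (max_eq_right le_one')).trans q.1.target⟩,
    d.reparam _ _ (fun _ _ h => max_le_max_left _ h) q.2⟩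

/-- The part of a directed path before time `s`. -/
def headPath {X : Type*} [TopologicalSpace X] {d : DStructure X} {y z : X} (q : d.DPath y z)
    (s : I) : d.DPath y (q.1 s) :=
  ⟨⟨q.1.toContinuousMap.comp ⟨fun t => min s t, by fun_prop⟩,
    (congrArg q.1 (min_eq_right nonneg')).trans q.1.source, congrArg q.1 (min_eq_left le_one')⟩,
    d.reparam _ _ (fun _ _ h => min_le_min_left _ h) q.2⟩

/-- The homotopy inverse is truncation by the minimum with `y`. Reachability enters through `x ≤ y`,
which keeps the starting point `x` fixed under truncation. -/
theorem isHomotopyEquivalence_concatRight {x y y' : K.space} (q : K.dStructure.DPath y y')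
    (hxy : K.dStructure.Reachable x y) (hc : K.CubeEquivalent y y') :
    IsHomotopyEquivalence (DPath.concatRight x q) := by
  obtain ⟨p₀⟩ := hxy
  have hle : ∀ i, (x : Fin n → ℝ) i ≤ (y : Fin n → ℝ) i := fun i => by
    simpa using source_le p₀ 1 i
  have hxq : ∀ s i, (x : Fin n → ℝ) i ≤ (q.1 s : Fin n → ℝ) i := fun s i =>
    (hle i).trans (source_le q s i)
  have hyy' : ∀ i, (y : Fin n → ℝ) i ≤ (y' : Fin n → ℝ) i := fun i => by
    simpa using source_le q 1 i
  let g : C(K.dStructure.DPath x y', K.dStructure.DPath x y) :=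
    ⟨minPath hc hle (fun _ => le_rfl) hyy', DPath.continuous_of_uncurry
      (continuous_of_coord fun i =>
        (continuous_coord continuous_fst continuous_snd i).min continuous_const)⟩
  refine .of_inverse _ g ?_ ?_
  -- Since `p ≤ y ≤ q` coordinatewise, truncating `p * q` at `y` leaves `p` and makes the second
  -- half constant.
  · refine DPath.homotopic_id_of_reparam _ firstHalf monotone_firstHalf firstHalf_zero
      firstHalf_one fun p t => Subtype.ext (funext fun i => ?_)
    show min ((p.1.trans q.1 t : Fin n → ℝ) i) ((y : Fin n → ℝ) i) = _
    rcases le_total (t : ℝ) (1 / 2) with ht | ht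
    · rw [Path.trans_of_le _ _ ht]
      exact min_eq_left (le_target p _ i)
    · rw [Path.trans_of_ge _ _ ht, firstHalf_of_ge ht, p.1.target]
      exact min_eq_right (source_le q _ i)
  -- Truncate at `q s` and continue along the remainder of `q`: `s = 0` is truncation at `y`
  -- followed by `q`, and `s = 1` is `p` followed by a constant path.
  · let F : I → K.dStructure.DPath x y' → K.dStructure.DPath x y' := fun s p =>
      (minPath hc (hxq s) (source_le q s) (le_target q s) p).concat (tailPath q s)
    have hF : Continuous fun r : (I × K.dStructure.DPath x y') × I => (F r.1.1 r.1.2).1 r.2 := by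
      refine Path.trans_continuous_family (ι := I × K.dStructure.DPath x y')
        (fun r => (minPath hc (hxq r.1) (source_le q r.1) (le_target q r.1) r.2).1) ?_
        (fun r => (tailPath q r.1).1) ?_
      · exact continuous_of_coord fun i =>
          (continuous_coord (continuous_snd.comp continuous_fst) continuous_snd i).min
            (continuous_coord continuous_const (continuous_fst.comp continuous_fst) i)
      · show Continuous fun r : (I × K.dStructure.DPath x y') × I => q.1 (max r.1.1 r.2)
        fun_prop
    have hF₁ : Continuous (F 1) :=
      (DPath.continuous_of_uncurry (g := fun r : I × K.dStructure.DPath x y' => F r.1 r.2) hF).comp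
        (Continuous.prodMk_right 1)
    refine ContinuousMap.Homotopic.trans (g := ⟨F 1, hF₁⟩)
      (DPath.homotopic_of_uncurry F hF (fun p t => ?_) fun p t => rfl)
      (DPath.homotopic_id_of_reparam _ firstHalf monotone_firstHalf firstHalf_zero
        firstHalf_one fun p t => ?_)
    -- The two concatenations are joined at `q.1 0` and at `y`, which are equal but not
    -- definitionally so; hence the comparison by values.
    · refine Subtype.ext (funext fun i => ?_)
      show (((minPath hc (hxq 0) (source_le q 0) (le_target q 0) p).1.trans (tailPath q 0).1) t :
        Fin n → ℝ) i = (((g p).1.trans q.1) t : Fin n → ℝ) i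
      rcases le_total (t : ℝ) (1 / 2) with ht | ht
      · rw [Path.trans_of_le _ _ ht, Path.trans_of_le _ _ ht]
        show min _ ((q.1 0 : Fin n → ℝ) i) = min _ ((y : Fin n → ℝ) i)
        rw [q.1.source]
      · rw [Path.trans_of_ge _ _ ht, Path.trans_of_ge _ _ ht]
        show (q.1 (max 0 (secondHalf t)) : Fin n → ℝ) i = _
        rw [max_eq_right nonneg']
    · refine Subtype.ext (funext fun i => ?_)
      show (((minPath hc (hxq 1) (source_le q 1) (le_target q 1) p).1.trans (tailPath q 1).1) t :
        Fin n → ℝ) i = _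
      rcases le_total (t : ℝ) (1 / 2) with ht | ht
      · rw [Path.trans_of_le _ _ ht]
        show min _ ((q.1 1 : Fin n → ℝ) i) = _
        rw [q.1.target]
        exact min_eq_left (le_target p _ i)
      · rw [Path.trans_of_ge _ _ ht, firstHalf_of_ge ht, p.1.target]
        show (q.1 (max 1 (secondHalf t)) : Fin n → ℝ) i = _
        rw [max_eq_left le_one', q.1.target]

/-- Dual to the previous case: the inverse is the maximum with `x`, and `x ≤ y` keeps the end point
`y` fixed. -/
theorem isHomotopyEquivalence_concatLeft {x' x y : K.space} (q : K.dStructure.DPath x' x)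
    (hxy : K.dStructure.Reachable x y) (hc : K.CubeEquivalent x' x) :
    IsHomotopyEquivalence (DPath.concatLeft q y) := by
  obtain ⟨p₀⟩ := hxy
  have hle : ∀ i, (x : Fin n → ℝ) i ≤ (y : Fin n → ℝ) i := fun i => by
    simpa using source_le p₀ 1 i
  have hqy : ∀ s i, (q.1 s : Fin n → ℝ) i ≤ (y : Fin n → ℝ) i := fun s i =>
    (le_target q s i).trans (hle i)
  have hx'x : ∀ i, (x' : Fin n → ℝ) i ≤ (x : Fin n → ℝ) i := fun i => by
    simpa using source_le q 1 i
  let g : C(K.dStructure.DPath x' y, K.dStructure.DPath x y) :=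
    ⟨maxPath hc hx'x (fun _ => le_rfl) hle, DPath.continuous_of_uncurry
      (continuous_of_coord fun i =>
        (continuous_coord continuous_fst continuous_snd i).max continuous_const)⟩
  refine .of_inverse _ g ?_ ?_
  · refine DPath.homotopic_id_of_reparam _ secondHalf monotone_secondHalf secondHalf_zero
      secondHalf_one fun p t => Subtype.ext (funext fun i => ?_)
    show max ((q.1.trans p.1 t : Fin n → ℝ) i) ((x : Fin n → ℝ) i) = _
    rcases le_total (t : ℝ) (1 / 2) with ht | ht
    · rw [Path.trans_of_le _ _ ht, secondHalf_of_le ht, p.1.source]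
      exact max_eq_right (le_target q _ i)
    · rw [Path.trans_of_ge _ _ ht]
      exact max_eq_left (source_le p _ i)
  -- Here `s = 1` is `q` followed by the maximum with `x`, and `s = 0` is a constant path followed
  -- by `p`, so the homotopy is used backwards.
  · let F : I → K.dStructure.DPath x' y → K.dStructure.DPath x' y := fun s p =>
      (headPath q s).concat (maxPath hc (source_le q s) (le_target q s) (hqy s) p)
    have hF : Continuous fun r : (I × K.dStructure.DPath x' y) × I => (F r.1.1 r.1.2).1 r.2 := by
      refine Path.trans_continuous_family (ι := I × K.dStructure.DPath x' y)
        (fun r => (headPath q r.1).1) ?_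
        (fun r => (maxPath hc (source_le q r.1) (le_target q r.1) (hqy r.1) r.2).1) ?_
      · show Continuous fun r : (I × K.dStructure.DPath x' y) × I => q.1 (min r.1.1 r.2)
        fun_prop
      · exact continuous_of_coord fun i =>
          (continuous_coord (continuous_snd.comp continuous_fst) continuous_snd i).max
            (continuous_coord continuous_const (continuous_fst.comp continuous_fst) i)
    have hF₀ : Continuous (F 0) :=
      (DPath.continuous_of_uncurry (g := fun r : I × K.dStructure.DPath x' y => F r.1 r.2) hF).comp
        (Continuous.prodMk_right 0)
    refine ContinuousMap.Homotopic.trans (g := ⟨F 0, hF₀⟩)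
      (DPath.homotopic_of_uncurry F hF (fun p t => rfl) fun p t => ?_).symm
      (DPath.homotopic_id_of_reparam _ secondHalf monotone_secondHalf secondHalf_zero
        secondHalf_one fun p t => ?_)
    · refine Subtype.ext (funext fun i => ?_)
      show (((headPath q 1).1.trans (maxPath hc (source_le q 1) (le_target q 1) (hqy 1) p).1) t :
        Fin n → ℝ) i = ((q.1.trans (g p).1) t : Fin n → ℝ) i
      rcases le_total (t : ℝ) (1 / 2) with ht | ht
      · rw [Path.trans_of_le _ _ ht, Path.trans_of_le _ _ ht]
        show (q.1 (min 1 (firstHalf t)) : Fin n → ℝ) i = _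
        rw [min_eq_right le_one']
      · rw [Path.trans_of_ge _ _ ht, Path.trans_of_ge _ _ ht]
        show max _ ((q.1 1 : Fin n → ℝ) i) = max _ ((x : Fin n → ℝ) i)
        rw [q.1.target]
    · refine Subtype.ext (funext fun i => ?_)
      show (((headPath q 0).1.trans (maxPath hc (source_le q 0) (le_target q 0) (hqy 0) p).1) t :
        Fin n → ℝ) i = _
      rcases le_total (t : ℝ) (1 / 2) with ht | ht
      · rw [Path.trans_of_le _ _ ht, secondHalf_of_le ht, p.1.source]
        show (q.1 (min 0 (firstHalf t)) : Fin n → ℝ) i = _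
        rw [min_eq_left nonneg', q.1.source]
      · rw [Path.trans_of_ge _ _ ht]
        show max _ ((q.1 0 : Fin n → ℝ) i) = _
        rw [q.1.source]
        exact max_eq_left (source_le p _ i)

/-! ### Natural parametrization and trace spaces -/

/-- The sum of the coordinates. -/
def coordSum (z : K.space) : ℝ := ∑ i, (z : Fin n → ℝ) i

@[fun_prop]
theorem continuous_coordSum : Continuous (coordSum (K := K)) := by
  unfold coordSum
  fun_prop

theorem abs_coordSum_sub_le (z w : K.space) : |coordSum z - coordSum w| ≤ n * dist z w := by
  unfold coordSum
  rw [← Finset.sum_sub_distrib]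
  refine (Finset.abs_sum_le_sum_abs _ _).trans ?_
  refine (Finset.sum_le_card_nsmul _ _ (dist z w) fun i _ => ?_).trans_eq (by simp)
  exact dist_le_pi_dist (z : Fin n → ℝ) w i

section

variable {x y : K.space}

theorem coordSum_mono (p : K.dStructure.DPath x y) {s t : I} (h : s ≤ t) :
    coordSum (p.1 s) ≤ coordSum (p.1 t) :=
  Finset.sum_le_sum fun i _ => dPath_mono p h i

/-- Along a directed path, distances are controlled by the sum of the coordinates. -/
theorem dist_le_coordSum (p : K.dStructure.DPath x y) (s t : I) :
    dist (p.1 s) (p.1 t) ≤ |coordSum (p.1 s) - coordSum (p.1 t)| := by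
  wlog h : s ≤ t generalizing s t
  · rw [dist_comm, abs_sub_comm]
    exact this t s (le_of_not_ge h)
  refine (dist_pi_le_iff (abs_nonneg _)).2 fun i => ?_
  rw [Real.dist_eq, abs_sub_comm, abs_sub_comm (coordSum _), abs_of_nonneg
    (sub_nonneg.2 (dPath_mono p h i)), abs_of_nonneg (sub_nonneg.2 (coordSum_mono p h))]
  unfold coordSum
  rw [← Finset.sum_sub_distrib]
  exact Finset.single_le_sum (f := fun i => (p.1 t : Fin n → ℝ) i - (p.1 s : Fin n → ℝ) i)
    (fun j _ => sub_nonneg.2 (dPath_mono p h j)) (Finset.mem_univ i)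

/-- The value at `u` of the affine function from the coordinate sum of `x` to that of `y`. -/
def sumLevel (x y : K.space) (u : I) : ℝ := coordSum x + u * (coordSum y - coordSum x)

theorem coordSum_le_of_dPath (p : K.dStructure.DPath x y) : coordSum x ≤ coordSum y := by
  simpa using coordSum_mono p (zero_le_one (α := I))

theorem sumLevel_mono (p : K.dStructure.DPath x y) : Monotone (sumLevel x y) := fun u v h =>
  add_le_add_right (mul_le_mul_of_nonneg_right (show (u : ℝ) ≤ v from h)
    (sub_nonneg.2 (coordSum_le_of_dPath p))) _

theorem exists_coordSum_eq_sumLevel (p : K.dStructure.DPath x y) (u : I) :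
    ∃ s, coordSum (p.1 s) = sumLevel x y u := by
  have h := intermediate_value_univ (0 : I) 1 (f := fun s => coordSum (p.1 s)) (by fun_prop)
  refine h ⟨?_, ?_⟩
  · simpa [sumLevel] using sumLevel_mono p (nonneg' (t := u))
  · simpa [sumLevel] using sumLevel_mono p (le_one' (t := u))

/-- The value at `u` of the natural parametrization of a directed path. -/
noncomputable def naturalFun (p : K.dStructure.DPath x y) (u : I) : K.space :=
  p.1 (exists_coordSum_eq_sumLevel p u).choose

/-- Points of a directed path with equal coordinate sums coincide by `dist_le_coordSum`, so the
choice in `naturalFun` is immaterial. -/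
theorem naturalFun_eq (p : K.dStructure.DPath x y) {u s : I}
    (h : coordSum (p.1 s) = sumLevel x y u) : naturalFun p u = p.1 s := by
  refine dist_le_zero.1 ((dist_le_coordSum p _ _).trans_eq ?_)
  rw [(exists_coordSum_eq_sumLevel p u).choose_spec, h, sub_self, abs_zero]

/-- This estimate yields joint continuity in path and parameter. For points `p s` and `q t` at
levels `u` and `v`, compare through `q s`: passing from `q s` to `p s` costs one distance of paths,
and replacing the sum at `q s` by that at `p s` costs `n` more. -/
theorem dist_naturalFun_le (p q : K.dStructure.DPath x y) (u v : I) :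
    dist (naturalFun q v) (naturalFun p u) ≤
      (n + 1) * dist q.1.toContinuousMap p.1.toContinuousMap +
        |((v : ℝ) - u)| * (coordSum y - coordSum x) := by
  obtain ⟨s, hs⟩ := exists_coordSum_eq_sumLevel p u
  obtain ⟨t, ht⟩ := exists_coordSum_eq_sumLevel q v
  rw [naturalFun_eq p hs, naturalFun_eq q ht]
  have h₁ : dist (q.1 s) (p.1 s) ≤ dist q.1.toContinuousMap p.1.toContinuousMap :=
    ContinuousMap.dist_apply_le_dist (f := q.1.toContinuousMap) (g := p.1.toContinuousMap) s
  have h₂ := dist_le_coordSum q t s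
  have h₃ : |coordSum (q.1 t) - coordSum (p.1 s)| = |(v : ℝ) - u| * (coordSum y - coordSum x) := by
    have h := abs_mul ((v : ℝ) - u) (coordSum y - coordSum x)
    rw [abs_of_nonneg (sub_nonneg.2 (coordSum_le_of_dPath p))] at h
    rw [hs, ht, ← h]
    congr 1
    unfold sumLevel
    ring
  have h₄ := abs_coordSum_sub_le (p.1 s) (q.1 s)
  have h₅ := abs_sub_le (coordSum (q.1 t)) (coordSum (p.1 s)) (coordSum (q.1 s))
  have h₆ := dist_triangle (q.1 t) (q.1 s) (p.1 s)
  rw [dist_comm (p.1 s)] at h₄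
  have h₇ := mul_le_mul_of_nonneg_left h₁ (Nat.cast_nonneg (α := ℝ) n)
  linarith

theorem continuous_naturalFun :
    Continuous fun q : K.dStructure.DPath x y × I => naturalFun q.1 q.2 := by
  refine continuous_iff_continuousAt.2 fun ⟨p, u⟩ => ?_
  refine tendsto_iff_dist_tendsto_zero.2 (squeeze_zero (fun _ => dist_nonneg)
    (fun q => dist_naturalFun_le p q.1 u q.2) ?_)
  have hc : Continuous fun q : K.dStructure.DPath x y × I => q.1.1.toContinuousMap :=
    continuous_induced_dom.comp (continuous_subtype_val.comp continuous_fst)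
  have h : Continuous fun q : K.dStructure.DPath x y × I =>
      (n + 1) * dist q.1.1.toContinuousMap p.1.toContinuousMap +
        |((q.2 : ℝ) - u)| * (coordSum y - coordSum x) := by
    fun_prop
  simpa using h.tendsto (p, u)

theorem naturalFun_mono (p : K.dStructure.DPath x y) :
    Monotone fun u => (naturalFun p u : Fin n → ℝ) := by
  intro u v huv
  obtain ⟨s, hs⟩ := exists_coordSum_eq_sumLevel p u
  obtain ⟨t, ht⟩ := exists_coordSum_eq_sumLevel p v
  simp only [naturalFun_eq p hs, naturalFun_eq p ht]
  rcases le_total s t with h | h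
  · exact dPath_mono p h
  -- If the chosen times come in the wrong order, the coordinate sums at `s` and `t` squeeze to
  -- equality and the two points agree.
  · have h' : coordSum (p.1 s) = sumLevel x y v :=
      le_antisymm (hs.trans_le (sumLevel_mono p huv)) (ht.symm.trans_le (coordSum_mono p h))
    rw [← naturalFun_eq p ht, ← naturalFun_eq p h']

/-- The function `φ` such that `p` is the natural parametrization composed with `φ`. -/
noncomputable def naturalTime (p : K.dStructure.DPath x y) (t : I) : I :=
  ⟨(coordSum (p.1 t) - coordSum x) / (coordSum y - coordSum x), by
    have h₁ := coordSum_mono p (nonneg' (t := t))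
    have h₂ := coordSum_mono p (le_one' (t := t))
    rw [p.1.source] at h₁
    rw [p.1.target] at h₂
    exact ⟨div_nonneg (by linarith) (by linarith), div_le_one_of_le₀ (by linarith) (by linarith)⟩⟩

theorem continuous_naturalTime :
    Continuous fun q : K.dStructure.DPath x y × I => naturalTime q.1 q.2 := by
  unfold naturalTime
  fun_prop

theorem naturalTime_mono (p : K.dStructure.DPath x y) : Monotone (naturalTime p) := fun _ _ h =>
  Subtype.coe_le_coe.1 <| div_le_div_of_nonneg_right (sub_le_sub_right (coordSum_mono p h) _)
    (sub_nonneg.2 (coordSum_le_of_dPath p))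

theorem sumLevel_naturalTime (p : K.dStructure.DPath x y) (t : I) :
    sumLevel x y (naturalTime p t) = coordSum (p.1 t) := by
  -- If the end points have equal sums, `naturalTime` is a quotient by zero, but its value is
  -- multiplied by zero and the sum is constant along `p`.
  rcases (coordSum_le_of_dPath p).eq_or_lt with h | h
  · have h₁ := coordSum_mono p (nonneg' (t := t))
    have h₂ := coordSum_mono p (le_one' (t := t))
    rw [p.1.source] at h₁
    rw [p.1.target] at h₂
    unfold sumLevel
    rw [h, sub_self, mul_zero]
    linarith
  · unfold sumLevel naturalTime
    have : coordSum y - coordSum x ≠ 0 := (sub_pos.2 h).ne'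
    field_simp
    ring

theorem naturalFun_naturalTime (p : K.dStructure.DPath x y) (t : I) :
    naturalFun p (naturalTime p t) = p.1 t :=
  naturalFun_eq p (sumLevel_naturalTime p t).symm

theorem naturalFun_of_sumLevel_eq_source (p : K.dStructure.DPath x y) {u : I}
    (h : sumLevel x y u = coordSum x) : naturalFun p u = x := by
  rw [naturalFun_eq p (s := 0) (by rw [p.1.source, h]), p.1.source]

theorem naturalFun_of_sumLevel_eq_target (p : K.dStructure.DPath x y) {u : I}
    (h : sumLevel x y u = coordSum y) : naturalFun p u = y := by
  rw [naturalFun_eq p (s := 1) (by rw [p.1.target, h]), p.1.target]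

theorem naturalTime_endpoints (p : K.dStructure.DPath x y) (h : coordSum x < coordSum y) :
    naturalTime p 0 = 0 ∧ naturalTime p 1 = 1 := by
  have : coordSum y - coordSum x ≠ 0 := (sub_pos.2 h).ne'
  exact ⟨Subtype.ext (by simp [naturalTime]), Subtype.ext (by simp [naturalTime, this])⟩

/-- The natural parametrization of a directed path, as a continuous map. -/
noncomputable def naturalCMap (p : K.dStructure.DPath x y) : C(I, K.space) :=
  ⟨naturalFun p, continuous_naturalFun.comp (Continuous.prodMk_right p)⟩

/-- The path `p` is its natural parametrization composed with `naturalTime p`, so a partition for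
`p` is carried forward by `naturalTime p`; by the intermediate value theorem each new subinterval is
covered by the image of the old one. -/
theorem isDPath_naturalCMap (p : K.dStructure.DPath x y) :
    K.dStructure.IsDPath (naturalCMap p) := by
  have hφ : Continuous (naturalTime p) := continuous_naturalTime.comp (Continuous.prodMk_right p)
  -- When the sums agree, `naturalTime p` is constantly `0` and carries no partition, but then the
  -- natural parametrization is `p` itself.
  rcases (coordSum_le_of_dPath p).eq_or_lt with h | h
  · have hp : naturalCMap p = p.1.toContinuousMap := by
      ext1 t
      refine naturalFun_eq p ?_
      rw [← sumLevel_naturalTime p]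
      unfold sumLevel
      rw [h, sub_self, mul_zero, mul_zero]
    rw [hp]
    exact p.2
  obtain ⟨hφ₀, hφ₁⟩ := naturalTime_endpoints p h
  obtain ⟨k, t, ht, h₀, h₁, hk⟩ := p.2
  refine ⟨k, fun i => naturalTime p (t i), (naturalTime_mono p).comp ht, by simp only [h₀, hφ₀],
    by simp only [h₁, hφ₁], fun i hi => ?_⟩
  obtain ⟨c, hc, hmem, -⟩ := hk i hi
  refine ⟨c, hc, fun u hu => ?_, (naturalFun_mono p).monotoneOn _⟩
  obtain ⟨s, hs, rfl⟩ := intermediate_value_Icc (ht (Nat.le_succ i)) hφ.continuousOn hu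
  show (naturalFun p (naturalTime p s) : Fin n → ℝ) ∈ _
  rw [naturalFun_naturalTime]
  exact hmem s hs

/-- The natural parametrization of a directed path. -/
noncomputable def natural (p : K.dStructure.DPath x y) : K.dStructure.DPath x y :=
  ⟨⟨naturalCMap p, naturalFun_of_sumLevel_eq_source p (by simp [sumLevel]),
    naturalFun_of_sumLevel_eq_target p (by simp [sumLevel])⟩, isDPath_naturalCMap p⟩

/-- A point of `p ∘ φ` with prescribed coordinate sum is also a point of `p` with that sum. -/
theorem natural_eq_of_isReparam {p q : K.dStructure.DPath x y} (h : IsReparam p q) :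
    natural p = natural q := by
  obtain ⟨φ, -, -, hφ⟩ := h
  refine Subtype.ext (Path.ext (funext fun u => ?_))
  obtain ⟨s, hs⟩ := exists_coordSum_eq_sumLevel q u
  show naturalFun p u = naturalFun q u
  rw [naturalFun_eq q hs, hφ, naturalFun_eq p (by rw [← hφ, hs])]

theorem traceProj_natural (p : K.dStructure.DPath x y) :
    traceProj K.dStructure x y (natural p) = traceProj K.dStructure x y p := by
  have hφ : Continuous (naturalTime p) := continuous_naturalTime.comp (Continuous.prodMk_right p)
  rcases (coordSum_le_of_dPath p).eq_or_lt with h | h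
  · congr 1
    refine Subtype.ext (Path.ext (funext fun t => naturalFun_eq p ?_))
    rw [← sumLevel_naturalTime p]
    unfold sumLevel
    rw [h, sub_self, mul_zero, mul_zero]
  · obtain ⟨hφ₀, hφ₁⟩ := naturalTime_endpoints p h
    refine Quot.sound ⟨⟨naturalTime p, hφ⟩, naturalTime_mono p, fun u => ?_, fun t =>
      (naturalFun_naturalTime p t).symm⟩
    exact mem_range_of_exists_le_of_exists_ge hφ ⟨0, hφ₀.trans_le nonneg'⟩
      ⟨1, le_one'.trans_eq hφ₁.symm⟩

/-- The projection from the space of directed paths to the trace space is a homotopy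
equivalence. -/
theorem isHomotopyEquivalence_traceProj (x y : K.space) :
    IsHomotopyEquivalence (traceProj K.dStructure x y) := by
  have hN : Continuous (natural (x := x) (y := y)) :=
    DPath.continuous_of_uncurry continuous_naturalFun
  let g : C(K.dStructure.Trace x y, K.dStructure.DPath x y) :=
    ⟨Quot.lift natural fun _ _ h => natural_eq_of_isReparam h, continuous_quot_lift _ hN⟩
  refine .of_inverse _ g ?_ ?_
  -- The homotopy reparametrizes `natural p` by interpolating between `t` and `naturalTime p t`. End
  -- points are checked on `sumLevel`, since `naturalTime p 1` need not be `1` when the sums agree.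
  · have hw : ∀ (p : K.dStructure.DPath x y) (s t : I), sumLevel x y (lerp s t (naturalTime p t)) =
        (1 - s) * sumLevel x y t + s * coordSum (p.1 t) := fun p s t => by
      rw [← sumLevel_naturalTime p]
      simp only [sumLevel, coe_lerp]
      ring
    have hφ : ∀ p : K.dStructure.DPath x y, Continuous (naturalTime p) := fun p =>
      continuous_naturalTime.comp (Continuous.prodMk_right p)
    refine DPath.homotopic_of_uncurry
      (fun s p => ⟨⟨(naturalCMap p).comp ⟨fun t => lerp s t (naturalTime p t),
          continuous_lerp continuous_const continuous_id (hφ p)⟩,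
        naturalFun_of_sumLevel_eq_source p ?_, naturalFun_of_sumLevel_eq_target p ?_⟩,
        K.dStructure.reparam _ _ (fun _ _ h => lerp_mono s h (naturalTime_mono p h))
          (isDPath_naturalCMap p)⟩) ?_ ?_ ?_
    · refine (hw p s 0).trans ?_
      rw [p.1.source]
      simp [sumLevel]
      ring
    · refine (hw p s 1).trans ?_
      rw [p.1.target]
      simp [sumLevel]
      ring
    · exact continuous_naturalFun.comp ((continuous_snd.comp continuous_fst).prodMk
        (continuous_lerp (continuous_fst.comp continuous_fst) continuous_snd
          (continuous_naturalTime.comp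
            ((continuous_snd.comp continuous_fst).prodMk continuous_snd))))
    · intro p t
      show naturalFun p (lerp 0 t (naturalTime p t)) = naturalFun p t
      rw [lerp_zero]
    · intro p t
      show naturalFun p (lerp 1 t (naturalTime p t)) = p.1 t
      rw [lerp_one, naturalFun_naturalTime]
  -- This composite is the identity on the nose, as `natural p` and `p` have the same trace.
  · have h : (traceProj K.dStructure x y).comp g = .id _ := by
      ext a
      obtain ⟨p, rfl⟩ := Quot.exists_rep a
      exact traceProj_natural p
    rw [h]

/-- A d-map inducing a homotopy equivalence on a space of directed paths also does so on the
trace space. -/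
theorem isHomotopyEquivalence_traceMap {f : C(K.space, K.space)}
    (hf : IsDMap K.dStructure K.dStructure f) (x y : K.space)
    (h : IsHomotopyEquivalence (pathCMap hf x y)) : IsHomotopyEquivalence (traceMap hf x y) :=
  ((isHomotopyEquivalence_traceProj x y).of_comp_right (g := traceCMap hf x y)
    ((isHomotopyEquivalence_traceProj (f x) (f y)).comp h))

end

/-! ### Straight-line homotopies between cube-preserving maps -/

theorem isCubePreserving_id (K : EuclideanCubicalComplex n) : K.IsCubePreserving (.id _) :=
  ⟨fun _ hp => hp, fun _ _ _ h => h, fun _ _ _ h => h⟩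

theorem lerp_mem_space {f g : C(K.space, K.space)} (hf : K.IsCubePreserving f)
    (hg : K.IsCubePreserving g) (x : K.space) (s : I) :
    (fun i => (1 - s) * (f x : Fin n → ℝ) i + s * (g x : Fin n → ℝ) i) ∈ K.space := by
  obtain ⟨c, hc, hx⟩ := K.exists_mem_openCell x
  exact K.mem_space.2 ⟨c, hc, c.openCell_subset_closedCell
    (c.openCell_lerp (hf.2.2 c hc x hx) (hg.2.2 c hc x hx) s fun _ => rfl)⟩

/-- The straight-line homotopy between two cube-preserving maps. -/
def lineHomotopy {f g : C(K.space, K.space)} (hf : K.IsCubePreserving f)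
    (hg : K.IsCubePreserving g) : C(K.space × I, K.space) :=
  ⟨fun q => ⟨fun i => (1 - q.2) * (f q.1 : Fin n → ℝ) i + q.2 * (g q.1 : Fin n → ℝ) i,
    lerp_mem_space hf hg q.1 q.2⟩, continuous_of_coord fun i => by
      show Continuous fun q : K.space × I =>
        (1 - q.2) * (f q.1 : Fin n → ℝ) i + q.2 * (g q.1 : Fin n → ℝ) i
      have hf' : Continuous fun x : K.space => (f x : Fin n → ℝ) i :=
        (continuous_apply i).comp (continuous_subtype_val.comp f.continuous)
      have hg' : Continuous fun x : K.space => (g x : Fin n → ℝ) i :=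
        (continuous_apply i).comp (continuous_subtype_val.comp g.continuous)
      have hs : Continuous fun q : K.space × I => (q.2 : ℝ) := by fun_prop
      exact ((continuous_const.sub hs).mul (hf'.comp continuous_fst)).add
        (hs.mul (hg'.comp continuous_fst))⟩

variable {f g : C(K.space, K.space)} (hf : K.IsCubePreserving f) (hg : K.IsCubePreserving g)

theorem lineHomotopy_zero (x : K.space) : lineHomotopy hf hg (x, 0) = f x :=
  Subtype.ext (funext fun i => by simp [lineHomotopy])

theorem lineHomotopy_one (x : K.space) : lineHomotopy hf hg (x, 1) = g x :=
  Subtype.ext (funext fun i => by simp [lineHomotopy])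

/-- Both maps preserve every closed cube, and cubes are convex, so the image stays in the cubes
visited by the path in `K.space`; `f ≤ g` makes it grow with the time parameter. -/
theorem isSimpleDHomotopy_lineHomotopy
    (hfg : ∀ (x : K.space) (i : Fin n), (f x : Fin n → ℝ) i ≤ (g x : Fin n → ℝ) i) :
    K.dStructure.IsSimpleDHomotopy (lineHomotopy hf hg) := by
  rintro p ⟨hp, hτ⟩
  refine isDPath_of_mapsTo hp (fun s t h i => ?_) fun s c hc hs => ?_
  · have h₁ := monotone_of_isDPath (hf.1 _ hp) h i
    have h₂ := monotone_of_isDPath (hg.1 _ hp) h i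
    have h₃ : ((p s).2 : ℝ) ≤ (p t).2 := hτ h
    have h₄ := hfg (p s).1 i
    have h₅ : (0 : ℝ) ≤ (p t).2 := (p t).2.2.1
    have h₆ : ((p t).2 : ℝ) ≤ 1 := (p t).2.2.2
    have h₇ : (f (p s).1 : Fin n → ℝ) i ≤ (f (p t).1 : Fin n → ℝ) i := h₁
    have h₈ : (g (p s).1 : Fin n → ℝ) i ≤ (g (p t).1 : Fin n → ℝ) i := h₂
    show (1 - (p s).2) * (f (p s).1 : Fin n → ℝ) i + (p s).2 * (g (p s).1 : Fin n → ℝ) i ≤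
      (1 - (p t).2) * (f (p t).1 : Fin n → ℝ) i + (p t).2 * (g (p t).1 : Fin n → ℝ) i
    -- With times `τ ≤ τ'` and values `f, g` growing to `f', g'`, the difference is `(τ' - τ)(g - f)
    -- + (1 - τ')(f' - f) + τ'(g' - g)`.
    nlinarith [mul_nonneg (sub_nonneg.2 h₃) (sub_nonneg.2 h₄),
      mul_nonneg (sub_nonneg.2 h₆) (sub_nonneg.2 h₇), mul_nonneg h₅ (sub_nonneg.2 h₈)]
  · exact c.closedCell_lerp (K.mapsTo_closedCell hc (hf.2.2 c hc) _ hs)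
      (K.mapsTo_closedCell hc (hg.2.2 c hc) _ hs) (p s).2 fun _ => rfl

theorem isCubePreserving_level
    (hfg : ∀ (x : K.space) (i : Fin n), (f x : Fin n → ℝ) i ≤ (g x : Fin n → ℝ) i) (s : I) :
    K.IsCubePreserving (DStructure.level (lineHomotopy hf hg) s) := by
  refine ⟨fun p hp => ?_, fun x i m hx => ?_, fun c hc x hx => ?_⟩
  · exact isSimpleDHomotopy_lineHomotopy hf hg hfg (p.prodMk (.const I s)) ⟨hp, monotone_const⟩
  · show (1 - s) * (f x : Fin n → ℝ) i + s * (g x : Fin n → ℝ) i = m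
    rw [hf.2.1 x i m hx, hg.2.1 x i m hx]
    ring
  · exact c.openCell_lerp (hf.2.2 c hc x hx) (hg.2.2 c hc x hx) s fun _ => rfl

/-! ### Path space preservation and inessential maps -/

theorem IsCubePreserving.reachable (hf : K.IsCubePreserving f) {x y : K.space}
    (hxy : K.dStructure.Reachable x y) :
    K.dStructure.Reachable (f x) (f y) :=
  hxy.map (pathMap hf.1 x y)

theorem IsCubePreserving.cubeEquivalent (hf : K.IsCubePreserving f) (x : K.space) :
    K.CubeEquivalent x (f x) := by
  obtain ⟨c, hc, hx⟩ := K.exists_mem_openCell x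
  exact ⟨c, hc, hx, hf.2.2 c hc x hx⟩

theorem CubeEquivalent.symm {x y : K.space} (h : K.CubeEquivalent x y) : K.CubeEquivalent y x := by
  obtain ⟨c, hc, hx, hy⟩ := h
  exact ⟨c, hc, hy, hx⟩

/-- Two-out-of-three for `α * H(y, -) ≃ H(x, -) * f(α)`, where `H` is the straight-line homotopy
from the identity to `f`. -/
theorem isPathSpacePreserving_of_isFutureType (hf : K.IsCubePreserving f) (h : K.IsFutureType f) :
    K.dStructure.IsPathSpacePreserving f := by
  refine ⟨hf.1, fun x y hxy => isHomotopyEquivalence_traceMap _ _ _ ?_⟩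
  have hid := isCubePreserving_id K
  have hH := isSimpleDHomotopy_lineHomotopy hid hf h
  have hhom := homotopic_track hH hid.1 hf.1 (lineHomotopy_zero hid hf)
    (lineHomotopy_one hid hf) x y
  exact (isHomotopyEquivalence_concatLeft _ (hf.reachable hxy) (hf.cubeEquivalent x)).of_comp_left
    ((isHomotopyEquivalence_concatRight _ hxy (hf.cubeEquivalent y)).of_homotopic hhom)

/-- Now `H` runs from `f` to the identity and `f(α) * H(y, -) ≃ H(x, -) * α`, so the concatenation
to be cancelled is the one at the end. -/
theorem isPathSpacePreserving_of_isPastType (hf : K.IsCubePreserving f) (h : K.IsPastType f) :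
    K.dStructure.IsPathSpacePreserving f := by
  refine ⟨hf.1, fun x y hxy => isHomotopyEquivalence_traceMap _ _ _ ?_⟩
  have hid := isCubePreserving_id K
  have hH := isSimpleDHomotopy_lineHomotopy hf hid h
  have hhom := homotopic_track hH hf.1 hid.1 (lineHomotopy_zero hf hid)
    (lineHomotopy_one hf hid) x y
  exact (isHomotopyEquivalence_concatRight _ (hf.reachable hxy)
    (hf.cubeEquivalent y).symm).of_comp_left
      ((isHomotopyEquivalence_concatLeft _ hxy (hf.cubeEquivalent x).symm).of_homotopic hhom.symm)

/-- Every level `(1 - s) x + s f(x)` is itself cube-preserving of future type, hence path space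
preserving. -/
theorem isFutureInessential (hf : K.IsCubePreserving f) (h : K.IsFutureType f) :
    K.dStructure.IsFutureInessential f := by
  have hid := isCubePreserving_id K
  refine ⟨lineHomotopy hid hf, isSimpleDHomotopy_lineHomotopy hid hf h,
    ContinuousMap.ext (lineHomotopy_zero hid hf), ContinuousMap.ext (lineHomotopy_one hid hf),
    fun s => isPathSpacePreserving_of_isFutureType (isCubePreserving_level hid hf h s)
      fun x i => ?_⟩
  show (x : Fin n → ℝ) i ≤ (1 - s) * (x : Fin n → ℝ) i + s * (f x : Fin n → ℝ) i
  linarith [mul_nonneg (show (0 : ℝ) ≤ s from s.2.1) (sub_nonneg.2 (h x i))]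

theorem isPastInessential (hf : K.IsCubePreserving f) (h : K.IsPastType f) :
    K.dStructure.IsPastInessential f := by
  have hid := isCubePreserving_id K
  refine ⟨lineHomotopy hf hid, isSimpleDHomotopy_lineHomotopy hf hid h,
    ContinuousMap.ext (lineHomotopy_zero hf hid), ContinuousMap.ext (lineHomotopy_one hf hid),
    fun s => isPathSpacePreserving_of_isPastType (isCubePreserving_level hf hid h s)
      fun x i => ?_⟩
  show (1 - s) * (f x : Fin n → ℝ) i + s * (x : Fin n → ℝ) i ≤ (x : Fin n → ℝ) i
  linarith [mul_nonneg (sub_nonneg.2 (show (s : ℝ) ≤ 1 from s.2.2)) (sub_nonneg.2 (h x i))]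

end EuclideanCubicalComplex

theorem mainTheorem8 (n : ℕ) (K : EuclideanCubicalComplex n) :
    (∀ h : C(K.space, K.space), K.IsCubePreserving h → K.IsFutureType h →
      K.dStructure.IsFutureInessential h) ∧
    (∀ h : C(K.space, K.space), K.IsCubePreserving h → K.IsPastType h →
      K.dStructure.IsPastInessential h) ∧
    (∀ (x y y' : K.space) (β : K.dStructure.DPath y y'),
      K.dStructure.Reachable x y → K.CubeEquivalent y y' →
      IsHomotopyEquivalence (fun α : K.dStructure.DPath x y => α.concat β)) ∧
    (∀ (x' x y : K.space) (β : K.dStructure.DPath x' x),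
      K.dStructure.Reachable x y → K.CubeEquivalent x' x →
      IsHomotopyEquivalence (fun α : K.dStructure.DPath x y => β.concat α)) :=
  ⟨fun _ hh h => EuclideanCubicalComplex.isFutureInessential hh h,
    fun _ hh h => EuclideanCubicalComplex.isPastInessential hh h,
    fun _ _ _ β h hc => EuclideanCubicalComplex.isHomotopyEquivalence_concatRight β h hc,
    fun _ _ _ β h hc => EuclideanCubicalComplex.isHomotopyEquivalence_concatLeft β h hc⟩
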